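/- Let $M$ be a smooth manifold (without boundary) modelled on a real Banach space, put $T^0M=M$, $T^{i+1}M=T(T^iM)$, and let $\pi_i:T^{i+1}M\to T^iM$ be the tangent bundle projections. Let $T^\infty M=\varprojlim(T^iM,\pi_i)$ be the infinite order iterated tangent bundle, with the limit topology and the limit charts $\varprojlim\phi_i$ (where $\phi_{i+1}=D\phi_i$ and $\phi_0$ is a chart of $M$), which take values in the Fréchet space that is the limit of the model spaces of the $T^iM$. Its tangent bundle and second tangent bundle are $TT^\infty M=\varprojlim (T(T^iM),D\pi_i)$ and $T^2T^\infty M=\varprojlim (T^2(T^iM),D^2\pi_i)$, again with limit charts. The projection of $TT^\infty M$ is $\pi_\infty=\varprojlim \pi_i:TT^\infty M\to T^\infty M$, the projection of $T^2T^\infty M$ is $\varprojlim\pi_{i+1}:T^2T^\infty M\to TT^\infty M$, and $D\pi_\infty=\varprojlim D\pi_i:T^2T^\infty M\to TT^\infty M$. For a Banach manifold $W$ let $\kappa_W:T^2W\to T^2W$ be the canonical involution, $(x,y,X,Y)\mapsto(x,X,y,Y)$ in the canonical charts. The complete lift of a vector field $A:TW\to T^2W$ on $TW$ is $A^c=D\kappa_W\circ\kappa_{TW}\circ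 DA\circ\kappa_W:T^2W\to T^3W$. A semispray on $W$ is a smooth vector field $S:TW\to T^2W$ on $TW$ with $D\pi_W\circ S=\mathrm{id}_{TW}$, where $\pi_W:TW\to W$ is the projection. A semispray on $T^\infty M$ is a map $S:TT^\infty M\to T^2T^\infty M$ that is smooth (continuous and, in the limit charts, possessing iterated directional derivatives of all orders that are jointly continuous), is a section of the projection $T^2T^\infty M\to TT^\infty M$, and satisfies $D\pi_\infty\circ S=\mathrm{id}$. **Proposition.** Let $S$ be a semispray on $M$, and put $S^{c_0}=S$ and $S^{c_{i+1}}=(S^{c_i})^c$, so that $S^{c_i}:T(T^iM)\to T^2(T^iM)$. Then the maps $S^{c_i}$ are smooth and form a projective system, i.e. $D^2\pi_i\circ S^{c_{i+1}}=S^{c_i}\circ D\pi_i$ for all $i\ge 0$; the map $D\pi_\infty=\varprojlim D\pi_i$ is the tangent map of $\pi_\infty$ (in limit charts, it is given by the directional derivatives of $\pi_\infty$); and the limit $S^{c_\infty}=\varprojlim S^{c_i}:TT^\infty M\to T^2T^\infty M$ is a semispray on $T^\infty M$. In particular $S^{c_\infty}$ is a smooth vector field on $TT^\infty M$ with $D\pi_\infty\circ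 S^{c_\infty}=\mathrm{id}$. -/

import Mathlib

open Set Filter Topology
open scoped Manifold ContDiff

universe u

noncomputable section

/-! ### Banach manifolds, iterated tangent bundles, complete lifts -/

/-- A smooth manifold without boundary modelled on a real Banach space `E`. The intermediate
topological space `H` is identified with `E` by the boundaryless model `I`. -/
structure BanachManifold : Type (u + 1) where
  E : Type u
  H : Type u
  carrier : Type u
  [normedAddCommGroup : NormedAddCommGroup E]
  [normedSpace : NormedSpace ℝ E]
  [completeSpace : CompleteSpace E]
  [topologicalSpaceH : TopologicalSpace H]
  I : ModelWithCorners ℝ E H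
  [boundaryless : I.Boundaryless]
  [topologicalSpace : TopologicalSpace carrier]
  [chartedSpace : ChartedSpace H carrier]
  [isManifold : IsManifold I ∞ carrier]

namespace BanachManifold

attribute [instance] normedAddCommGroup normedSpace completeSpace topologicalSpaceH boundaryless
  topologicalSpace chartedSpace isManifold

instance : CoeSort BanachManifold.{u} (Type u) := ⟨carrier⟩

/-- The tangent bundle `TW`, as a Banach manifold modelled on `E × E`. -/
def tangent (W : BanachManifold.{u}) : BanachManifold.{u} where
  E := W.E × W.E
  H := ModelProd W.H W.E
  carrier := TangentBundle W.I W
  I := W.I.tangent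

/-- The natural projection `π : TW → W`. -/
def proj (W : BanachManifold.{u}) : W.tangent → W :=
  fun v => Bundle.TotalSpace.proj (F := W.E) (E := (TangentSpace W.I : W → Type u)) v

/-- Smooth maps. -/
def Smooth {W V : BanachManifold.{u}} (f : W → V) : Prop := ContMDiff W.I V.I ∞ f

/-- The tangent map `Df : TW → TV`. -/
def D {W V : BanachManifold.{u}} (f : W → V) : W.tangent → V.tangent := tangentMap W.I V.I f

/-- The canonical involution `κ : TTW → TTW`, given in the canonical charts of `TTW` by
`(x, y, X, Y) ↦ (x, X, y, Y)`. -/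
def kappa (W : BanachManifold.{u}) (z : W.tangent.tangent) : W.tangent.tangent :=
  let c := chartAt W.tangent.tangent.H z
  let q : (W.H × W.E) × (W.E × W.E) := c z
  c.symm (((q.1.1, q.2.1), (q.1.2, q.2.2)) : (W.H × W.E) × (W.E × W.E))

/-- A (smooth) vector field on `W`. -/
structure IsVectorField (W : BanachManifold.{u}) (A : W → W.tangent) : Prop where
  smooth : Smooth A
  proj_comp : W.proj ∘ A = id

/-- A semispray on `W`: a vector field `S` on `TW` such that `Dπ ∘ S = id`. -/
structure IsSemispray (W : BanachManifold.{u}) (S : W.tangent → W.tangent.tangent) : Prop where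
  isVectorField : W.tangent.IsVectorField S
  D_proj_comp : D W.proj ∘ S = id

/-- The complete lift `A^c = Dκ ∘ κ ∘ DA ∘ κ` of a vector field `A` on `TW`; it is a vector field
on `TTW`. -/
def completeLift (W : BanachManifold.{u}) (A : W.tangent → W.tangent.tangent) :
    W.tangent.tangent → W.tangent.tangent.tangent :=
  D W.kappa ∘ W.tangent.kappa ∘ D A ∘ W.kappa

/-- The iterated tangent bundle: `T⁰M = M` and `Tⁱ⁺¹M = T(TⁱM)`. -/
def iterTangent (M : BanachManifold.{u}) : ℕ → BanachManifold.{u}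
  | 0 => M
  | i + 1 => (iterTangent M i).tangent

/-- The iterated complete lifts `S^{c_i} : T(TⁱM) → T²(TⁱM)`, `S^{c_0} = S` and
`S^{c_{i+1}} = (S^{c_i})^c`. -/
def iterCompleteLift (M : BanachManifold.{u}) (S : M.tangent → M.tangent.tangent) :
    ∀ i : ℕ, (M.iterTangent i).tangent → (M.iterTangent i).tangent.tangent
  | 0 => S
  | i + 1 => (M.iterTangent i).completeLift (iterCompleteLift M S i)

theorem smooth_proj (W : BanachManifold.{u}) : Smooth W.proj :=
  Bundle.contMDiff_proj (F := W.E) (IB := W.I) (n := ∞) (TangentSpace W.I : W.carrier → Type u)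

theorem Smooth.D {W V : BanachManifold.{u}} {f : W → V} (hf : Smooth f) :
    Smooth (BanachManifold.D f) :=
  ContMDiff.contMDiff_tangentMap hf (m := ∞) (by simp)

theorem Smooth.mdiff {W V : BanachManifold.{u}} {f : W → V} (hf : Smooth f) :
    MDifferentiable W.I V.I f :=
  ContMDiff.mdifferentiable hf (by simp)

theorem D_comp {W V U : BanachManifold.{u}} {f : W → V} {g : V → U} (hg : Smooth g)
    (hf : Smooth f) : D (g ∘ f) = D g ∘ D f :=
  tangentMap_comp hg.mdiff hf.mdiff

/-- The first component of the canonical chart of `TW`. -/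
theorem extChartAt_tangent_fst (W : BanachManifold.{u}) (ξ η : W.tangent) :
    (extChartAt W.tangent.I ξ η).1 = extChartAt W.I (W.proj ξ) (W.proj η) := by
  rfl

/-- The second component of the canonical chart of `TW` is the derivative of the chart of `W`. -/
theorem extChartAt_tangent_snd (W : BanachManifold.{u}) (ξ η : W.tangent)
    (h : W.proj η ∈ (extChartAt W.I (W.proj ξ)).source) :
    (extChartAt W.tangent.I ξ η).2 =
      mfderiv W.I 𝓘(ℝ, W.E) (extChartAt W.I (W.proj ξ)) (W.proj η) η.2 := by
  rw [extChartAt_source] at h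
  rw [← TangentBundle.continuousLinearMapAt_trivializationAt h,
    TangentBundle.continuousLinearMapAt_trivializationAt_eq_core h]
  rfl

theorem mem_extChartAt_tangent_source (W : BanachManifold.{u}) (ξ η : W.tangent) :
    η ∈ (extChartAt W.tangent.I ξ).source ↔
      W.proj η ∈ (extChartAt W.I (W.proj ξ)).source := by
  rw [extChartAt_source, extChartAt_source]
  exact TangentBundle.mem_chart_source_iff (I := W.I) (M := W.carrier) η ξ

theorem mem_extChartAt_tangent_target (W : BanachManifold.{u}) (ξ : W.tangent)
    (e : W.E × W.E) :
    e ∈ (extChartAt W.tangent.I ξ).target ↔ e.1 ∈ (extChartAt W.I (W.proj ξ)).target := by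
  rw [extChartAt_target, extChartAt_target, ModelWithCorners.range_eq_univ,
    ModelWithCorners.range_eq_univ, inter_univ, inter_univ]
  exact TangentBundle.mem_chart_target_iff (I := W.I) (M := W.carrier) _ ξ

end BanachManifold

/-! ### Projective systems of Banach manifolds and their limits -/

/-- A projective sequence of Banach manifolds `N₀ ← N₁ ← ⋯` with smooth connecting maps `p i`,
whose model spaces form a projective sequence with continuous linear connecting maps `ρ i`,
such that the charts around a point form a projective family (`chart_comm`) whose limit has open
domain and open image (`source_iff`, `target_iff`). -/
structure ProjSystem : Type (u + 1) where
  N : ℕ → BanachManifold.{u}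
  p : ∀ i, N (i + 1) → N i
  ρ : ∀ i, (N (i + 1)).E →L[ℝ] (N i).E
  smooth : ∀ i, BanachManifold.Smooth (p i)
  source_iff : ∀ i (x y : N (i + 1)), y ∈ (extChartAt (N (i + 1)).I x).source ↔
    p i y ∈ (extChartAt (N i).I (p i x)).source
  target_iff : ∀ i (x : N (i + 1)) (e : (N (i + 1)).E),
    e ∈ (extChartAt (N (i + 1)).I x).target ↔ ρ i e ∈ (extChartAt (N i).I (p i x)).target
  chart_comm : ∀ i (x y : N (i + 1)), y ∈ (extChartAt (N (i + 1)).I x).source →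
    ρ i (extChartAt (N (i + 1)).I x y) = extChartAt (N i).I (p i x) (p i y)

namespace ProjSystem

open BanachManifold

/-- The tower `M ← TM ← T²M ← ⋯` of iterated tangent bundles. -/
def tower (M : BanachManifold.{u}) : ProjSystem.{u} where
  N := M.iterTangent
  p i := (M.iterTangent i).proj
  ρ i := ContinuousLinearMap.fst ℝ (M.iterTangent i).E (M.iterTangent i).E
  smooth _ := smooth_proj _
  source_iff i x y := mem_extChartAt_tangent_source (M.iterTangent i) x y
  target_iff i x e := mem_extChartAt_tangent_target (M.iterTangent i) x e
  chart_comm i x y _ := extChartAt_tangent_fst (M.iterTangent i) x y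

theorem ρ_mfderiv_extChartAt (𝒩 : ProjSystem.{u}) (i : ℕ) (x y : 𝒩.N (i + 1))
    (hy : y ∈ (extChartAt (𝒩.N (i + 1)).I x).source)
    (v : TangentSpace (𝒩.N (i + 1)).I y) :
    𝒩.ρ i (mfderiv (𝒩.N (i + 1)).I 𝓘(ℝ, (𝒩.N (i + 1)).E)
        (extChartAt (𝒩.N (i + 1)).I x) y v) =
      mfderiv (𝒩.N i).I 𝓘(ℝ, (𝒩.N i).E) (extChartAt (𝒩.N i).I (𝒩.p i x)) (𝒩.p i y)
        (mfderiv (𝒩.N (i + 1)).I (𝒩.N i).I (𝒩.p i) y v) := by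
  have hy' := (𝒩.source_iff i _ _).1 hy
  have hev : (𝒩.ρ i) ∘ (extChartAt (𝒩.N (i + 1)).I x) =ᶠ[𝓝 y]
      (extChartAt (𝒩.N i).I (𝒩.p i x)) ∘ 𝒩.p i := by
    filter_upwards [extChartAt_source_mem_nhds' hy] with z hz
    exact 𝒩.chart_comm i x z hz
  have h1 : MDifferentiableAt (𝒩.N (i + 1)).I 𝓘(ℝ, (𝒩.N (i + 1)).E)
      (extChartAt (𝒩.N (i + 1)).I x) y :=
    mdifferentiableAt_extChartAt (by rwa [extChartAt_source] at hy)
  have h2 : MDifferentiableAt (𝒩.N i).I 𝓘(ℝ, (𝒩.N i).E)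
      (extChartAt (𝒩.N i).I (𝒩.p i x)) (𝒩.p i y) :=
    mdifferentiableAt_extChartAt (by rwa [extChartAt_source] at hy')
  have h3 : MDifferentiableAt (𝒩.N (i + 1)).I (𝒩.N i).I (𝒩.p i) y := (𝒩.smooth i).mdiff y
  have h4 : MDifferentiableAt 𝓘(ℝ, (𝒩.N (i + 1)).E) 𝓘(ℝ, (𝒩.N i).E) (𝒩.ρ i)
      (extChartAt (𝒩.N (i + 1)).I x y) := (𝒩.ρ i).mdifferentiableAt
  have key := hev.mfderiv_eq (I := (𝒩.N (i + 1)).I) (I' := 𝓘(ℝ, (𝒩.N i).E))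
  rw [mfderiv_comp y h4 h1, mfderiv_comp y h2 h3, ContinuousLinearMap.mfderiv_eq] at key
  exact congrArg (fun L : (𝒩.N (i + 1)).E →L[ℝ] (𝒩.N i).E => L v) key

/-- The tangent system `TN₀ ← TN₁ ← ⋯` with connecting maps `D(p i)`. -/
def tangent (𝒩 : ProjSystem.{u}) : ProjSystem.{u} where
  N i := (𝒩.N i).tangent
  p i := D (𝒩.p i)
  ρ i := (𝒩.ρ i).prodMap (𝒩.ρ i)
  smooth i := (𝒩.smooth i).D
  source_iff i x y := by
    rw [mem_extChartAt_tangent_source, mem_extChartAt_tangent_source]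
    exact 𝒩.source_iff i _ _
  target_iff i x e :=
    (mem_extChartAt_tangent_target (𝒩.N (i + 1)) x e).trans
      ((𝒩.target_iff i _ _).trans
        (mem_extChartAt_tangent_target (𝒩.N i) (D (𝒩.p i) x)
          (((𝒩.ρ i).prodMap (𝒩.ρ i)) e)).symm)
  chart_comm i x y hy := by
    rw [mem_extChartAt_tangent_source] at hy
    have hy' := (𝒩.source_iff i _ _).1 hy
    refine Prod.ext (𝒩.chart_comm i _ _ hy) ?_
    have e1 := extChartAt_tangent_snd (𝒩.N (i + 1)) x y hy
    have e2 := extChartAt_tangent_snd (𝒩.N i) (D (𝒩.p i) x) (D (𝒩.p i) y) hy'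
    refine Eq.trans ?_ e2.symm
    refine (congrArg (𝒩.ρ i) e1).trans ?_
    exact ρ_mfderiv_extChartAt 𝒩 i _ _ hy y.2

/-- The projective limit `lim Nᵢ`, as a subspace of the product. -/
def lim (𝒩 : ProjSystem.{u}) : Type u :=
  {x : ∀ i, 𝒩.N i // ∀ i, 𝒩.p i (x (i + 1)) = x i}

instance (𝒩 : ProjSystem.{u}) : TopologicalSpace 𝒩.lim :=
  inferInstanceAs (TopologicalSpace {x : ∀ i, 𝒩.N i // ∀ i, 𝒩.p i (x (i + 1)) = x i})

/-- The model space `lim Eᵢ` of `lim Nᵢ`, a Fréchet space. -/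
def model (𝒩 : ProjSystem.{u}) : Submodule ℝ (∀ i, (𝒩.N i).E) where
  carrier := {e | ∀ i, 𝒩.ρ i (e (i + 1)) = e i}
  add_mem' ha hb i := by simp [ha i, hb i]
  zero_mem' i := by simp
  smul_mem' c a ha i := by simp [ha i]

/-- The domain `lim Uᵢ` of the limit chart around `x`. -/
def chartSource (𝒩 : ProjSystem.{u}) (x : 𝒩.lim) : Set 𝒩.lim :=
  {y | ∀ i, y.1 i ∈ (extChartAt (𝒩.N i).I (x.1 i)).source}

/-- The image of the limit chart around `x`. -/
def chartTarget (𝒩 : ProjSystem.{u}) (x : 𝒩.lim) : Set 𝒩.model :=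
  {e | ∀ i, e.1 i ∈ (extChartAt (𝒩.N i).I (x.1 i)).target}

open Classical in
/-- The limit chart `lim φᵢ : lim Uᵢ → lim Eᵢ` around `x` (extended by `0` off its domain). -/
def chart (𝒩 : ProjSystem.{u}) (x y : 𝒩.lim) : 𝒩.model :=
  if h : y ∈ 𝒩.chartSource x then
    ⟨fun i => extChartAt (𝒩.N i).I (x.1 i) (y.1 i), fun i => by
      have := 𝒩.chart_comm i (x.1 (i + 1)) (y.1 (i + 1)) (h (i + 1))
      rwa [x.2 i, y.2 i] at this⟩
  else 0

open Classical in
/-- The inverse of the limit chart around `x` (extended by `x` off its domain). -/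
def chartSymm (𝒩 : ProjSystem.{u}) (x : 𝒩.lim) (e : 𝒩.model) : 𝒩.lim :=
  if h : e ∈ 𝒩.chartTarget x then
    ⟨fun i => (extChartAt (𝒩.N i).I (x.1 i)).symm (e.1 i), fun i => by
      have hs := (extChartAt (𝒩.N (i + 1)).I (x.1 (i + 1))).map_target (h (i + 1))
      have h1 := 𝒩.chart_comm i (x.1 (i + 1)) _ hs
      have h2 := (𝒩.source_iff i (x.1 (i + 1)) _).1 hs
      rw [(extChartAt (𝒩.N (i + 1)).I (x.1 (i + 1))).right_inv (h (i + 1)), e.2 i, x.2 i] at h1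
      rw [x.2 i] at h2
      exact ((extChartAt (𝒩.N i).I (x.1 i)).left_inv h2).symm.trans
        (congrArg (extChartAt (𝒩.N i).I (x.1 i)).symm h1.symm)⟩
  else x

/-- A morphism of projective systems of manifolds. -/
structure Hom (𝒩 𝒬 : ProjSystem.{u}) where
  f : ∀ i, 𝒩.N i → 𝒬.N i
  smooth : ∀ i, BanachManifold.Smooth (f i)
  comm : ∀ i, 𝒬.p i ∘ f (i + 1) = f i ∘ 𝒩.p i

/-- The limit map `lim fᵢ : lim Nᵢ → lim Pᵢ`. -/
def Hom.limMap {𝒩 𝒬 : ProjSystem.{u}} (F : Hom 𝒩 𝒬) (x : 𝒩.lim) : 𝒬.lim :=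
  ⟨fun i => F.f i (x.1 i), fun i => by
    have := congrFun (F.comm i) (x.1 (i + 1))
    simpa only [Function.comp_apply, x.2 i] using this⟩

/-- The morphism `(Dfᵢ)` of tangent systems; its limit map is the tangent map of `lim fᵢ`. -/
def Hom.tangent {𝒩 𝒬 : ProjSystem.{u}} (F : Hom 𝒩 𝒬) : Hom 𝒩.tangent 𝒬.tangent where
  f i := D (F.f i)
  smooth i := (F.smooth i).D
  comm i := by
    have := congrArg D (F.comm i)
    rwa [D_comp (𝒬.smooth i) (F.smooth _), D_comp (F.smooth i) (𝒩.smooth i)] at this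

/-- The morphism of tangent bundle projections `πᵢ : TNᵢ → Nᵢ`. -/
def projHom (𝒩 : ProjSystem.{u}) : Hom 𝒩.tangent 𝒩 where
  f i := (𝒩.N i).proj
  smooth _ := smooth_proj _
  comm _ := rfl

/-- The tangent bundle projection `lim πᵢ : T(lim Nᵢ) = lim TNᵢ → lim Nᵢ`. -/
def limProj (𝒩 : ProjSystem.{u}) : 𝒩.tangent.lim → 𝒩.lim := 𝒩.projHom.limMap

/-- The tangent map `lim Dπᵢ : T²(lim Nᵢ) → T(lim Nᵢ)` of the tangent bundle projection. -/
def limDProj (𝒩 : ProjSystem.{u}) : 𝒩.tangent.tangent.lim → 𝒩.tangent.lim :=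
  𝒩.projHom.tangent.limMap

end ProjSystem

/-- Smoothness (in the sense of Michal and Bastiani) of a map `f` between locally convex spaces on
an open set `U`: all iterated directional derivatives `dⁿf(x; v₁, …, vₙ)` exist for `x ∈ U` and are
jointly continuous in `(x, v₁, …, vₙ)`. -/
def BastianiSmoothOn {E F : Type*} [AddCommGroup E] [Module ℝ E] [TopologicalSpace E]
    [AddCommGroup F] [Module ℝ F] [TopologicalSpace F] (f : E → F) (U : Set E) : Prop :=
  ∃ d : ∀ n : ℕ, E → (Fin n → E) → F,
    (∀ x ∈ U, ∀ v, d 0 x v = f x) ∧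
    (∀ n, ContinuousOn (fun q : E × (Fin n → E) => d n q.1 q.2) (U ×ˢ univ)) ∧
    ∀ n, ∀ x ∈ U, ∀ (v : E) (w : Fin n → E),
      Tendsto (fun t : ℝ => t⁻¹ • (d n (x + t • v) w - d n x w)) (𝓝[≠] 0)
        (𝓝 (d (n + 1) x (Fin.cons v w)))

namespace ProjSystem

/-- Smooth maps between limits of projective systems: continuous maps which are smooth in the limit
charts. -/
def LimSmooth {𝒩 𝒬 : ProjSystem.{u}} (f : 𝒩.lim → 𝒬.lim) : Prop :=
  Continuous f ∧ ∀ x : 𝒩.lim,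
    BastianiSmoothOn (fun e => 𝒬.chart (f x) (f (𝒩.chartSymm x e)))
      {e | e ∈ 𝒩.chartTarget x ∧ f (𝒩.chartSymm x e) ∈ 𝒬.chartSource (f x)}

/-- The fibre coordinate of a tangent vector `ξ` of `lim Nᵢ` in the limit chart around its base
point. -/
def fiberCoord (𝒩 : ProjSystem.{u}) (ξ : 𝒩.tangent.lim) : 𝒩.model :=
  ⟨fun i => ((𝒩.tangent.chart ξ ξ).1 i).2,
    fun i => congrArg Prod.snd ((𝒩.tangent.chart ξ ξ).2 i)⟩

/-- `f'` is the tangent map of `f`: it covers `f` and its action on a tangent vector `ξ` at `x` is,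
in the limit charts around `x` and `f x`, the derivative of `f` in the direction `ξ`. -/
def HasTangentMap {𝒩 𝒬 : ProjSystem.{u}} (f : 𝒩.lim → 𝒬.lim)
    (f' : 𝒩.tangent.lim → 𝒬.tangent.lim) : Prop :=
  ∀ (ξ : 𝒩.tangent.lim) (x : 𝒩.lim), 𝒩.limProj ξ = x →
    𝒬.limProj (f' ξ) = f x ∧
    Tendsto (fun t : ℝ => t⁻¹ •
        (𝒬.chart (f x) (f (𝒩.chartSymm x (𝒩.chart x x + t • 𝒩.fiberCoord ξ))) -
          𝒬.chart (f x) (f x)))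
      (𝓝[≠] 0) (𝓝 (𝒬.fiberCoord (f' ξ)))

/-- A (smooth) vector field on `lim Nᵢ`. -/
structure IsVectorField (𝒩 : ProjSystem.{u}) (A : 𝒩.lim → 𝒩.tangent.lim) : Prop where
  smooth : LimSmooth A
  proj_comp : 𝒩.limProj ∘ A = id

/-- A semispray on `lim Nᵢ`: a vector field `S` on `T(lim Nᵢ)` with `Dπ ∘ S = id`. -/
structure IsSemispray (𝒩 : ProjSystem.{u}) (S : 𝒩.tangent.lim → 𝒩.tangent.tangent.lim) :
    Prop where
  isVectorField : 𝒩.tangent.IsVectorField S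
  D_proj_comp : 𝒩.limDProj ∘ S = id

end ProjSystem

end

noncomputable section

/-! ### The canonical involution in charts of the second tangent bundle -/

namespace BanachManifold

/-! Everything rests on identities for the canonical involution: `κ ∘ κ = id`, `π_{TW} ∘ κ = Dπ_W`
(`proj_comp_kappa`) and the naturality `D²π_W ∘ κ_{TW} = κ_W ∘ D²π_W` (`D_D_proj_comp_kappa`). They
are visible in coordinates once `κ` is known to be the flip `(x, y, X, Y) ↦ (x, X, y, Y)` in every
canonical chart (`extChartAt_kappa`), which is the symmetry of second derivatives applied to a
change of charts. Inserted into `A^c = Dκ ∘ κ ∘ DA ∘ κ`, they give the compatibility `D²π ∘ A^c = A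
∘ Dπ` for any `A`, and show that the complete lift of a semispray is again a semispray; induction
treats all levels.

For the limit, a morphism of projective systems is levelwise a smooth map of Banach manifolds. The
Fréchet derivatives of its chart expressions are intertwined by the linear connecting maps
(`iteratedFDeriv_intertwine`), so they assemble into Bastiani derivatives of the limit map
(`bastianiSmoothOn_limMap`). The semispray identities pass to the limit coordinate by coordinate.
Finally `π_∞` is a continuous linear projection in limit charts, so its derivative is read off
directly. -/

theorem extChartAt_tangent_congr (W : BanachManifold.{u}) {ξ η : W.tangent}
    (h : W.proj ξ = W.proj η) : extChartAt W.tangent.I ξ = extChartAt W.tangent.I η := by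
  have h' : chartAt W.tangent.H ξ = chartAt W.tangent.H η := by
    have e := fun ζ : TangentBundle W.I W =>
      FiberBundle.chartedSpace_chartAt (HB := W.H) (F := W.E) (E := (TangentSpace W.I : W → Type u)) ζ
    refine (e ξ).trans (Eq.trans ?_ (e η).symm)
    change W.proj ξ = W.proj η at h
    have h2 : Bundle.TotalSpace.proj (F := W.E) (E := (TangentSpace W.I : W → Type u)) ξ =
      Bundle.TotalSpace.proj (F := W.E) (E := (TangentSpace W.I : W → Type u)) η := h
    rw [h2]
  rw [extChartAt, extChartAt, h']

/-- The fibre coordinates of a tangent vector in two charts differ by the derivative of the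
change of charts. -/
theorem extChartAt_tangent_snd_change (W : BanachManifold.{u}) (ξ ξ' η : W.tangent)
    (h : W.proj η ∈ (extChartAt W.I (W.proj ξ)).source)
    (h' : W.proj η ∈ (extChartAt W.I (W.proj ξ')).source) :
    (extChartAt W.tangent.I ξ' η).2 =
      fderiv ℝ (extChartAt W.I (W.proj ξ') ∘ (extChartAt W.I (W.proj ξ)).symm)
        (extChartAt W.I (W.proj ξ) (W.proj η)) (extChartAt W.tangent.I ξ η).2 := by
  rw [extChartAt_tangent_snd W ξ η h, extChartAt_tangent_snd W ξ' η h']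
  have hev : extChartAt W.I (W.proj ξ') =ᶠ[𝓝 (W.proj η)]
      (extChartAt W.I (W.proj ξ') ∘ (extChartAt W.I (W.proj ξ)).symm) ∘
        extChartAt W.I (W.proj ξ) := by
    filter_upwards [extChartAt_source_mem_nhds' h] with z hz
    simp only [Function.comp_apply]
    rw [(extChartAt W.I (W.proj ξ)).left_inv hz]
  have h1 : MDifferentiableAt W.I 𝓘(ℝ, W.E) (extChartAt W.I (W.proj ξ)) (W.proj η) :=
    mdifferentiableAt_extChartAt (by rwa [extChartAt_source] at h)
  have h2 : DifferentiableAt ℝ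
      (extChartAt W.I (W.proj ξ') ∘ (extChartAt W.I (W.proj ξ)).symm)
      (extChartAt W.I (W.proj ξ) (W.proj η)) := by
    have := contDiffWithinAt_ext_coord_change (I := W.I) (n := ∞) (W.proj ξ') (W.proj ξ)
      (y := extChartAt W.I (W.proj ξ) (W.proj η))
      (by
        rw [PartialEquiv.trans_source, mem_inter_iff]
        refine ⟨(extChartAt W.I (W.proj ξ)).map_source h, ?_⟩
        rw [mem_preimage, (extChartAt W.I (W.proj ξ)).left_inv h]; exact h')
    rw [ModelWithCorners.range_eq_univ, contDiffWithinAt_univ] at this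
    exact this.differentiableAt (by simp)
  have key := hev.mfderiv_eq (I := W.I) (I' := 𝓘(ℝ, W.E))
  rw [mfderiv_comp (W.proj η) h2.mdifferentiableAt h1, mfderiv_eq_fderiv] at key
  exact congrArg (fun L : W.E →L[ℝ] W.E => L η.2) key

/-- The model of the canonical involution. -/
def flip {E : Type*} (q : (E × E) × (E × E)) : (E × E) × (E × E) :=
  ((q.1.1, q.2.1), (q.1.2, q.2.2))

/-- The second tangent map of a `C²` map commutes with `flip`. -/
theorem fderiv_tangent_flip {E F : Type*} [NormedAddCommGroup E] [NormedSpace ℝ E]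
    [NormedAddCommGroup F] [NormedSpace ℝ F] {τ : E → F} {τ₁ : E × E → F × F} {x : E}
    (hτ : ContDiffAt ℝ ∞ τ x) (y X Y : E)
    (h₁ : ∀ y, τ₁ =ᶠ[𝓝 (x, y)] fun q => (τ q.1, fderiv ℝ τ q.1 q.2)) :
    (τ₁ (x, X), fderiv ℝ τ₁ (x, X) (y, Y)) = flip (τ₁ (x, y), fderiv ℝ τ₁ (x, y) (X, Y)) := by
  have hd : DifferentiableAt ℝ (fderiv ℝ τ) x :=
    (hτ.fderiv_right (m := 1) (by norm_cast)).differentiableAt (by simp)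
  have hs : IsSymmSndFDerivAt ℝ τ x := hτ.isSymmSndFDerivAt (by
    rw [minSmoothness_of_isRCLikeNormedField]
    exact WithTop.coe_le_coe.2 (le_top : (2 : ℕ∞) ≤ ⊤))
  have h0 : ∀ y, τ₁ (x, y) = (τ x, fderiv ℝ τ x y) := fun y => (h₁ y).self_of_nhds
  -- Product rule for `(x, y) ↦ (τ x, Dτ(x) y)`. The only term that is not visibly compatible with
  -- exchanging `y` and `X` is `D²τ(x)(X, y)`, which symmetry settles.
  have h2 : ∀ y X Y, fderiv ℝ τ₁ (x, y) (X, Y) =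
      (fderiv ℝ τ x X, fderiv ℝ (fderiv ℝ τ) x X y + fderiv ℝ τ x Y) := by
    intro y X Y
    rw [(h₁ y).fderiv_eq]
    have hf : HasFDerivAt (fun q : E × E => q.1) (ContinuousLinearMap.fst ℝ E E) (x, y) :=
      hasFDerivAt_fst
    have hg : HasFDerivAt (fun q : E × E => q.2) (ContinuousLinearMap.snd ℝ E E) (x, y) :=
      hasFDerivAt_snd
    have e1 : HasFDerivAt (fun q : E × E => τ q.1) _ (x, y) :=
      HasFDerivAt.comp (x, y) (g := τ) (hτ.differentiableAt (by simp)).hasFDerivAt hf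
    have e2 : HasFDerivAt (fun q : E × E => fderiv ℝ τ q.1) _ (x, y) :=
      HasFDerivAt.comp (x, y) (g := fderiv ℝ τ) hd.hasFDerivAt hf
    rw [(e1.prodMk (e2.clm_apply hg)).fderiv]
    simp [add_comm]
  rw [h0, h0, h2, h2, flip]
  simp only [Prod.mk.injEq, true_and]
  rw [hs.eq X y]

theorem chartAt_tangent_mem_target (W : BanachManifold.{u}) (z : W.tangent.tangent)
    (q : (W.H × W.E) × (W.E × W.E)) :
    q ∈ (chartAt W.tangent.tangent.H z).target ↔
      q.1.1 ∈ (chartAt W.H (W.proj (W.tangent.proj z))).target :=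
  (TangentBundle.mem_chart_target_iff (I := W.tangent.I) (M := W.tangent.carrier) _ z).trans
    (TangentBundle.mem_chart_target_iff (I := W.I) (M := W.carrier) _ (W.tangent.proj z))

theorem mem_extChartAt_tangent_tangent_source (W : BanachManifold.{u})
    (z w : W.tangent.tangent) :
    w ∈ (extChartAt W.tangent.tangent.I z).source ↔
      W.proj (W.tangent.proj w) ∈ (extChartAt W.I (W.proj (W.tangent.proj z))).source :=
  (mem_extChartAt_tangent_source W.tangent z w).trans
    (mem_extChartAt_tangent_source W _ _)


/-- Membership in the chart target depends only on the base coordinate, which the flip fixes; hence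
the flipped coordinates are genuine coordinates of `W.kappa z`. This concerns only the chart at `z`
itself, the one used to define `kappa`. -/
theorem proj_proj_kappa_and_chart (W : BanachManifold.{u}) (z : W.tangent.tangent) :
    W.proj (W.tangent.proj (W.kappa z)) = W.proj (W.tangent.proj z) ∧
      extChartAt W.tangent.tangent.I z (W.kappa z) = flip (extChartAt W.tangent.tangent.I z z) := by
  set q : (W.H × W.E) × (W.E × W.E) := chartAt W.tangent.tangent.H z z with hq
  have hzt : q ∈ (chartAt W.tangent.tangent.H z).target :=
    (chartAt W.tangent.tangent.H z).map_source (mem_chart_source _ z)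
  have ht : (((q.1.1, q.2.1), (q.1.2, q.2.2)) : (W.H × W.E) × (W.E × W.E)) ∈
      (chartAt W.tangent.tangent.H z).target :=
    (chartAt_tangent_mem_target W z _).2 ((chartAt_tangent_mem_target W z q).1 hzt)
  have hc : chartAt W.tangent.tangent.H z (W.kappa z) =
      (((q.1.1, q.2.1), (q.1.2, q.2.2)) : (W.H × W.E) × (W.E × W.E)) :=
    (chartAt W.tangent.tangent.H z).right_inv ht
  have hs : W.kappa z ∈ (chartAt W.tangent.tangent.H z).source :=
    (chartAt W.tangent.tangent.H z).map_target ht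
  have he : extChartAt W.tangent.tangent.I z (W.kappa z) =
      flip (extChartAt W.tangent.tangent.I z z) :=
    congrArg W.tangent.tangent.I hc
  refine ⟨?_, he⟩
  have hs' : W.kappa z ∈ (extChartAt W.tangent.tangent.I z).source := by
    rwa [extChartAt_source]
  have hs1 := (mem_extChartAt_tangent_tangent_source W z _).1 hs'
  refine (extChartAt W.I (W.proj (W.tangent.proj z))).injOn hs1 (mem_extChartAt_source _) ?_
  exact congrArg (fun e : (W.E × W.E) × (W.E × W.E) => e.1.1) he

theorem proj_proj_kappa (W : BanachManifold.{u}) (z : W.tangent.tangent) :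
    W.proj (W.tangent.proj (W.kappa z)) = W.proj (W.tangent.proj z) :=
  (proj_proj_kappa_and_chart W z).1

/-- The change of charts of `TTW` commutes with `flip`. -/
theorem extChartAt_tangent_tangent_flip_change (W : BanachManifold.{u})
    (z z' w w' : W.tangent.tangent)
    (hb : W.proj (W.tangent.proj w') = W.proj (W.tangent.proj w))
    (h : w ∈ (extChartAt W.tangent.tangent.I z).source)
    (h' : w ∈ (extChartAt W.tangent.tangent.I z').source)
    (hw : extChartAt W.tangent.tangent.I z w' = flip (extChartAt W.tangent.tangent.I z w)) :
    extChartAt W.tangent.tangent.I z' w' = flip (extChartAt W.tangent.tangent.I z' w) := by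
  have b := (mem_extChartAt_tangent_tangent_source W z w).1 h
  have b' := (mem_extChartAt_tangent_tangent_source W z' w).1 h'
  set φ := extChartAt W.I (W.proj (W.tangent.proj z)) with hφ
  set φ' := extChartAt W.I (W.proj (W.tangent.proj z')) with hφ'
  set ψ := extChartAt W.tangent.I (W.tangent.proj z) with hψ
  set ψ' := extChartAt W.tangent.I (W.tangent.proj z') with hψ'
  let τ : W.E → W.E := φ' ∘ φ.symm
  let τ₁ : W.E × W.E → W.E × W.E := ψ' ∘ ψ.symm
  let x : W.E := φ (W.proj (W.tangent.proj w))
  have hxt : x ∈ φ.target := φ.map_source b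
  have hxs : x ∈ (φ.symm ≫ φ').source := by
    rw [PartialEquiv.trans_source, mem_inter_iff]
    refine ⟨hxt, ?_⟩
    rw [mem_preimage, φ.left_inv b]; exact b'
  have hτ : ContDiffAt ℝ ∞ τ x := by
    have := contDiffWithinAt_ext_coord_change (I := W.I) (n := ∞) (W.proj (W.tangent.proj z'))
      (W.proj (W.tangent.proj z)) (y := x) hxs
    rwa [ModelWithCorners.range_eq_univ, contDiffWithinAt_univ] at this
  have hopen : (φ.symm ≫ φ').source ∈ 𝓝 x := by
    rw [PartialEquiv.trans_source] at hxs ⊢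
    exact inter_mem (extChartAt_target_mem_nhds' hxt)
      ((continuousAt_extChartAt_symm'' hxt).preimage_mem_nhds (extChartAt_source_mem_nhds' hxs.2))
  -- The change of charts of `TW` is the tangent map of the change of charts of `W`, on the whole
  -- cylinder over the overlap; every `y` is needed because the flip moves `(x, y)` to `(x, X)`.
  have h₁ : ∀ y, τ₁ =ᶠ[𝓝 (x, y)] fun q => (τ q.1, fderiv ℝ τ q.1 q.2) := by
    intro y
    have : (fun q : W.E × W.E => q.1) ⁻¹' (φ.symm ≫ φ').source ∈ 𝓝 (x, y) :=
      continuous_fst.continuousAt.preimage_mem_nhds hopen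
    filter_upwards [this] with q hq
    rw [mem_preimage, PartialEquiv.trans_source, mem_inter_iff] at hq
    have hqt : q ∈ ψ.target := (mem_extChartAt_tangent_target W _ q).2 hq.1
    have hr : ψ (ψ.symm q) = q := ψ.right_inv hqt
    have hr1 : φ (W.proj (ψ.symm q)) = q.1 := congrArg Prod.fst hr
    have hps : W.proj (ψ.symm q) ∈ φ.source :=
      (mem_extChartAt_tangent_source W _ _).1 (ψ.map_target hqt)
    have hp : W.proj (ψ.symm q) = φ.symm q.1 := by rw [← hr1, φ.left_inv hps]
    refine Prod.ext ?_ ?_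
    · exact congrArg φ' hp
    · have := extChartAt_tangent_snd_change W (W.tangent.proj z) (W.tangent.proj z') (ψ.symm q)
        hps (by rw [hp]; exact hq.2)
      refine this.trans ?_
      change fderiv ℝ τ (φ (W.proj (ψ.symm q))) (ψ (ψ.symm q)).2 = _
      rw [hr1, hr]
  -- One level up, the change of charts of `TTW` is the tangent map of `τ₁`.
  have hchange : ∀ v : W.tangent.tangent, v ∈ (extChartAt W.tangent.tangent.I z).source →
      v ∈ (extChartAt W.tangent.tangent.I z').source →
      extChartAt W.tangent.tangent.I z' v =
        (τ₁ (extChartAt W.tangent.tangent.I z v).1,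
          fderiv ℝ τ₁ (extChartAt W.tangent.tangent.I z v).1
            (extChartAt W.tangent.tangent.I z v).2) := by
    intro v hv hv'
    have hv1 := (mem_extChartAt_tangent_source W.tangent z v).1 hv
    have hv1' := (mem_extChartAt_tangent_source W.tangent z' v).1 hv'
    refine Prod.ext ?_ (extChartAt_tangent_snd_change W.tangent z z' v hv1 hv1')
    exact (congrArg ψ' (ψ.left_inv hv1)).symm
  have hs : w' ∈ (extChartAt W.tangent.tangent.I z).source := by
    rw [mem_extChartAt_tangent_tangent_source, hb]; exact b
  have hs' : w' ∈ (extChartAt W.tangent.tangent.I z').source := by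
    rw [mem_extChartAt_tangent_tangent_source, hb]; exact b'
  rw [hchange w' hs hs', hchange w h h', hw]
  set e : (W.E × W.E) × (W.E × W.E) := extChartAt W.tangent.tangent.I z w with he
  have hx : e.1.1 = x := rfl
  obtain ⟨⟨e1, y⟩, ⟨X, Y⟩⟩ := e
  obtain rfl : e1 = x := hx
  exact fderiv_tangent_flip hτ y X Y h₁

/-- In every canonical chart of `TTW`, the canonical involution is `flip`. -/
theorem extChartAt_kappa (W : BanachManifold.{u}) (z w : W.tangent.tangent)
    (h : w ∈ (extChartAt W.tangent.tangent.I z).source) :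
    extChartAt W.tangent.tangent.I z (W.kappa w) =
      flip (extChartAt W.tangent.tangent.I z w) :=
  extChartAt_tangent_tangent_flip_change W w z w _ (proj_proj_kappa W w)
    (mem_extChartAt_source _) h (proj_proj_kappa_and_chart W w).2

theorem kappa_mem_source (W : BanachManifold.{u}) {z w : W.tangent.tangent}
    (h : w ∈ (extChartAt W.tangent.tangent.I z).source) :
    W.kappa w ∈ (extChartAt W.tangent.tangent.I z).source := by
  rw [mem_extChartAt_tangent_tangent_source, proj_proj_kappa]
  exact (mem_extChartAt_tangent_tangent_source W z w).1 h

theorem kappa_comp_kappa (W : BanachManifold.{u}) : W.kappa ∘ W.kappa = id := by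
  funext z
  have hz := mem_extChartAt_source (I := W.tangent.tangent.I) z
  refine (extChartAt W.tangent.tangent.I z).injOn
    (kappa_mem_source W (kappa_mem_source W hz)) hz ?_
  rw [extChartAt_kappa W z _ (kappa_mem_source W hz), extChartAt_kappa W z z hz]
  rfl

theorem contDiff_flip {E : Type*} [NormedAddCommGroup E] [NormedSpace ℝ E] :
    ContDiff ℝ ∞ (flip : (E × E) × (E × E) → (E × E) × (E × E)) := by
  unfold flip
  fun_prop

/-- The definition of `kappa` uses a chart that varies with the point; `extChartAt_kappa` replaces
it near `z` by the fixed chart at `z`, where the map is linear. -/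
theorem smooth_kappa (W : BanachManifold.{u}) : Smooth W.kappa := by
  intro z
  have hz := mem_extChartAt_source (I := W.tangent.tangent.I) z
  have h1 : ContMDiffAt W.tangent.tangent.I 𝓘(ℝ, W.tangent.tangent.E) ∞
      (extChartAt W.tangent.tangent.I z) z := contMDiffAt_extChartAt
  let f : W.tangent.tangent.E → W.tangent.tangent.E := @flip W.E
  have hf : ContDiff ℝ ∞ f := contDiff_flip (E := W.E)
  have h2 : ContMDiffAt 𝓘(ℝ, W.tangent.tangent.E) 𝓘(ℝ, W.tangent.tangent.E) ∞
      f (extChartAt W.tangent.tangent.I z z) :=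
    hf.contMDiff.contMDiffAt
  have ht : f (extChartAt W.tangent.tangent.I z z) ∈
      (extChartAt W.tangent.tangent.I z).target := by
    change flip _ ∈ _
    rw [← extChartAt_kappa W z z hz]
    exact (extChartAt W.tangent.tangent.I z).map_source (kappa_mem_source W hz)
  have h3 : ContMDiffAt 𝓘(ℝ, W.tangent.tangent.E) W.tangent.tangent.I ∞
      (extChartAt W.tangent.tangent.I z).symm (f (extChartAt W.tangent.tangent.I z z)) :=
    (contMDiffOn_extChartAt_symm z).contMDiffAt (extChartAt_target_mem_nhds' ht)
  refine (ContMDiffAt.comp z (g := (extChartAt W.tangent.tangent.I z).symm)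
    (f := f ∘ extChartAt W.tangent.tangent.I z) h3 (h2.comp z h1)).congr_of_eventuallyEq ?_
  filter_upwards [extChartAt_source_mem_nhds (I := W.tangent.tangent.I) z] with w hw
  refine ((extChartAt W.tangent.tangent.I z).left_inv (kappa_mem_source W hw)).symm.trans ?_
  exact congrArg _ (extChartAt_kappa W z w hw)

/-- The canonical chart of the tangent map of the projection `TW → W`. -/
theorem extChartAt_D_proj (W : BanachManifold.{u}) (z w : W.tangent.tangent)
    (h : w ∈ (extChartAt W.tangent.tangent.I z).source) :
    extChartAt W.tangent.I (D W.proj z) (D W.proj w) =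
      ((extChartAt W.tangent.tangent.I z w).1.1, (extChartAt W.tangent.tangent.I z w).2.1) :=
  ((ProjSystem.tower W).tangent.chart_comm 0 z w h).symm

/-! ### Projection identities for the involution -/

theorem proj_comp_kappa (W : BanachManifold.{u}) : W.tangent.proj ∘ W.kappa = D W.proj := by
  funext z
  have hz := mem_extChartAt_source (I := W.tangent.tangent.I) z
  -- The two sides are a priori read in charts at different points of `TW`; these points share a
  -- base point in `W`, so the charts coincide.
  have hc : extChartAt W.tangent.I (W.tangent.proj z) = extChartAt W.tangent.I (D W.proj z) :=
    extChartAt_tangent_congr W rfl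
  have h1 : W.tangent.proj (W.kappa z) ∈ (extChartAt W.tangent.I (D W.proj z)).source := by
    rw [← hc]
    exact (mem_extChartAt_tangent_source W.tangent z _).1 (kappa_mem_source W hz)
  refine (extChartAt W.tangent.I (D W.proj z)).injOn h1 (mem_extChartAt_source _) ?_
  rw [extChartAt_D_proj W z z hz, ← hc]
  exact congrArg Prod.fst (extChartAt_kappa W z z hz)

theorem D_proj_comp_kappa (W : BanachManifold.{u}) : D W.proj ∘ W.kappa = W.tangent.proj := by
  rw [← proj_comp_kappa, Function.comp_assoc, kappa_comp_kappa, Function.comp_id]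

/-- The canonical involution is natural with respect to the projection `TW → W`. -/
theorem D_D_proj_comp_kappa (W : BanachManifold.{u}) :
    D (D W.proj) ∘ W.tangent.kappa = W.kappa ∘ D (D W.proj) := by
  funext z
  have hz := mem_extChartAt_source (I := W.tangent.tangent.tangent.I) z
  -- `D²π_W` is the zeroth connecting map of this system, so `chart_comm` presents it as a product
  -- of four first projections, which commutes with the flip by computation.
  let T := (ProjSystem.tower W).tangent.tangent
  have hk := kappa_mem_source W.tangent hz
  have hy := mem_extChartAt_source (I := W.tangent.tangent.I) (D (D W.proj) z)
  refine (extChartAt W.tangent.tangent.I (D (D W.proj) z)).injOn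
    ((T.source_iff 0 z (W.tangent.kappa z)).1 hk) (kappa_mem_source W hy) ?_
  refine (T.chart_comm 0 z (W.tangent.kappa z) hk).symm.trans ?_
  refine Eq.trans ?_ (extChartAt_kappa W _ _ hy).symm
  refine Eq.trans ?_ (congrArg flip (T.chart_comm 0 z z hz))
  exact congrArg (T.ρ 0) (extChartAt_kappa W.tangent z z hz)

theorem D_id (W : BanachManifold.{u}) : D (id : W → W) = id := tangentMap_id

/-! ### Complete lifts -/

variable {W : BanachManifold.{u}} {A : W.tangent → W.tangent.tangent}

theorem smooth_completeLift (hA : Smooth A) : Smooth (W.completeLift A) :=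
  ContMDiff.comp (smooth_kappa W).D (ContMDiff.comp (smooth_kappa W.tangent)
    (ContMDiff.comp hA.D (smooth_kappa W)))

/-- The complete lift of `A` projects to `A`. -/
theorem D_D_proj_comp_completeLift (A : W.tangent → W.tangent.tangent) :
    D (D W.proj) ∘ W.completeLift A = A ∘ D W.proj := by
  have h1 : D (D W.proj) ∘ D W.kappa = D W.tangent.proj := by
    rw [← D_comp (smooth_proj W).D (smooth_kappa W), D_proj_comp_kappa]
  calc D (D W.proj) ∘ W.completeLift A
      = (D (D W.proj) ∘ D W.kappa) ∘ W.tangent.kappa ∘ D A ∘ W.kappa := rfl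
    _ = (D W.tangent.proj ∘ W.tangent.kappa) ∘ D A ∘ W.kappa := by rw [h1]; rfl
    _ = (W.tangent.tangent.proj ∘ D A) ∘ W.kappa := by rw [D_proj_comp_kappa]; rfl
    -- A tangent map covers its base map by definition, so no smoothness of `A` enters.
    _ = A ∘ (W.tangent.proj ∘ W.kappa) := rfl
    _ = A ∘ D W.proj := by rw [proj_comp_kappa]

/-- Moving the projection inward turns it into `Dπ_{TW}`, which cancels `DA` by the chain rule and
leaves `κ ∘ κ`. -/
theorem proj_comp_completeLift (hA : W.tangent.IsVectorField A) :
    W.tangent.tangent.proj ∘ W.completeLift A = id := by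
  calc W.tangent.tangent.proj ∘ W.completeLift A
      = W.kappa ∘ (W.tangent.tangent.proj ∘ W.tangent.kappa) ∘ D A ∘ W.kappa := rfl
    _ = W.kappa ∘ (D W.tangent.proj ∘ D A) ∘ W.kappa := by rw [proj_comp_kappa]; rfl
    _ = W.kappa ∘ W.kappa := by
      rw [← D_comp (smooth_proj W.tangent) hA.smooth, hA.proj_comp, D_id]; rfl
    _ = id := kappa_comp_kappa W

/-- The complete lift of a semispray on `W` is a semispray on `TW`. -/
theorem IsSemispray.completeLift (hA : W.IsSemispray A) :
    W.tangent.IsSemispray (W.completeLift A) := by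
  refine ⟨⟨smooth_completeLift hA.isVectorField.smooth,
    proj_comp_completeLift hA.isVectorField⟩, ?_⟩
  have h1 : D W.tangent.proj ∘ D W.kappa = D (D W.proj) := by
    rw [← D_comp (smooth_proj W.tangent) (smooth_kappa W), proj_comp_kappa]
  calc D W.tangent.proj ∘ W.completeLift A
      = (D W.tangent.proj ∘ D W.kappa) ∘ W.tangent.kappa ∘ D A ∘ W.kappa := rfl
    _ = (D (D W.proj) ∘ W.tangent.kappa) ∘ D A ∘ W.kappa := by rw [h1]; rfl
    _ = W.kappa ∘ (D (D W.proj) ∘ D A) ∘ W.kappa := by rw [D_D_proj_comp_kappa]; rfl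
    _ = W.kappa ∘ W.kappa := by
      rw [← D_comp (smooth_proj W).D hA.isVectorField.smooth, hA.D_proj_comp, D_id]; rfl
    _ = id := kappa_comp_kappa W

theorem IsSemispray.iterCompleteLift {M : BanachManifold.{u}} {S : M.tangent → M.tangent.tangent}
    (hS : M.IsSemispray S) : ∀ i, (M.iterTangent i).IsSemispray (M.iterCompleteLift S i)
  | 0 => hS
  | i + 1 => (IsSemispray.iterCompleteLift hS i).completeLift

end BanachManifold

/-! ### Iterated derivatives and linear intertwining -/

/-- Iterated derivatives of maps intertwined by continuous linear maps are intertwined. -/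
theorem iteratedFDeriv_intertwine {E E' F F' : Type*}
    [NormedAddCommGroup E] [NormedSpace ℝ E] [NormedAddCommGroup E'] [NormedSpace ℝ E']
    [NormedAddCommGroup F] [NormedSpace ℝ F] [NormedAddCommGroup F'] [NormedSpace ℝ F']
    {g : E → F} {g' : E' → F'} {a : E →L[ℝ] E'} {b : F →L[ℝ] F'} {U : Set E} {U' : Set E'}
    (hU : IsOpen U) (hU' : IsOpen U') (hUU' : MapsTo a U U') (hg : ContDiffOn ℝ ∞ g U)
    (hg' : ContDiffOn ℝ ∞ g' U') (h : ∀ e ∈ U, b (g e) = g' (a e)) (n : ℕ) {e : E} (he : e ∈ U)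
    (w : Fin n → E) :
    b (iteratedFDeriv ℝ n g e w) = iteratedFDeriv ℝ n g' (a e) fun k => a (w k) := by
  induction n generalizing e with
  | zero => simpa using h e he
  | succ n ih =>
    have hd : DifferentiableAt ℝ (iteratedFDeriv ℝ n g) e :=
      (hg.contDiffAt (hU.mem_nhds he)).differentiableAt_iteratedFDeriv
        (by exact_mod_cast WithTop.coe_lt_top _)
    have hd' : DifferentiableAt ℝ (iteratedFDeriv ℝ n g') (a e) :=
      (hg'.contDiffAt (hU'.mem_nhds (hUU' he))).differentiableAt_iteratedFDeriv
        (by exact_mod_cast WithTop.coe_lt_top _)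
    -- The induction hypothesis holds on all of the open set `U`, so it can be differentiated once
    -- more; the last `n` directions stay fixed.
    have hev : (fun e => b (iteratedFDeriv ℝ n g e (Fin.tail w))) =ᶠ[𝓝 e]
        fun e => iteratedFDeriv ℝ n g' (a e) fun k => a (Fin.tail w k) := by
      filter_upwards [hU.mem_nhds he] with e' he'
      exact ih he' _
    have h1 : HasFDerivAt (fun e => b (iteratedFDeriv ℝ n g e (Fin.tail w))) _ e :=
      b.hasFDerivAt.comp e ((ContinuousMultilinearMap.apply ℝ (fun _ : Fin n => E) F
        (Fin.tail w)).hasFDerivAt.comp e hd.hasFDerivAt)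
    have h2 : HasFDerivAt (fun e => iteratedFDeriv ℝ n g' (a e) fun k => a (Fin.tail w k)) _ e :=
      (ContinuousMultilinearMap.apply ℝ (fun _ : Fin n => E') F'
        fun k => a (Fin.tail w k)).hasFDerivAt.comp e (hd'.hasFDerivAt.comp e a.hasFDerivAt)
    have := congrArg (fun L : E →L[ℝ] F' => L (w 0)) (h1.unique (h2.congr_of_eventuallyEq hev))
    simpa [iteratedFDeriv_succ_apply_left, Fin.tail_def] using this

/-- The directional derivative of an iterated derivative. -/
theorem tendsto_iteratedFDeriv_cons {E F : Type*} [NormedAddCommGroup E] [NormedSpace ℝ E]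
    [NormedAddCommGroup F] [NormedSpace ℝ F] {g : E → F} {e : E} (hg : ContDiffAt ℝ ∞ g e)
    (n : ℕ) (v : E) (w : Fin n → E) :
    Tendsto (fun t : ℝ => t⁻¹ • (iteratedFDeriv ℝ n g (e + t • v) w - iteratedFDeriv ℝ n g e w))
      (𝓝[≠] 0) (𝓝 (iteratedFDeriv ℝ (n + 1) g e (Fin.cons v w))) := by
  have hd : DifferentiableAt ℝ (iteratedFDeriv ℝ n g) e :=
    hg.differentiableAt_iteratedFDeriv (by exact_mod_cast WithTop.coe_lt_top _)
  have h1 : HasFDerivAt (fun e => iteratedFDeriv ℝ n g e w) _ e :=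
    (ContinuousMultilinearMap.apply ℝ (fun _ : Fin n => E) F w).hasFDerivAt.comp e hd.hasFDerivAt
  have h2 := (h1.hasLineDerivAt v).tendsto_slope_zero
  simpa [iteratedFDeriv_succ_apply_left] using h2

/-! ### Limit charts -/

namespace ProjSystem

open BanachManifold

variable {𝒩 𝒬 : ProjSystem.{u}}

/-- The conditions at successive levels are equivalent, so the infinite intersection collapses to
level `0`. The analogous collapse for targets makes them open in the product topology. -/
theorem mem_chartSource_iff (x y : 𝒩.lim) :
    y ∈ 𝒩.chartSource x ↔ y.1 0 ∈ (extChartAt (𝒩.N 0).I (x.1 0)).source := by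
  refine ⟨fun h => h 0, fun h i => ?_⟩
  induction i with
  | zero => exact h
  | succ i ih =>
    rw [𝒩.source_iff, x.2 i, y.2 i]
    exact ih

theorem mem_chartTarget_iff (x : 𝒩.lim) (e : 𝒩.model) :
    e ∈ 𝒩.chartTarget x ↔ e.1 0 ∈ (extChartAt (𝒩.N 0).I (x.1 0)).target := by
  refine ⟨fun h => h 0, fun h i => ?_⟩
  induction i with
  | zero => exact h
  | succ i ih =>
    rw [𝒩.target_iff, x.2 i, e.2 i]
    exact ih

theorem mem_chartSource_self (x : 𝒩.lim) : x ∈ 𝒩.chartSource x :=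
  fun _ => mem_extChartAt_source _

theorem chart_apply {x y : 𝒩.lim} (h : y ∈ 𝒩.chartSource x) (i : ℕ) :
    (𝒩.chart x y).1 i = extChartAt (𝒩.N i).I (x.1 i) (y.1 i) := by
  rw [chart, dif_pos h]

theorem chartSymm_apply {x : 𝒩.lim} {e : 𝒩.model} (h : e ∈ 𝒩.chartTarget x) (i : ℕ) :
    (𝒩.chartSymm x e).1 i = (extChartAt (𝒩.N i).I (x.1 i)).symm (e.1 i) := by
  exact congrArg (fun y : 𝒩.lim => y.1 i) (dif_pos h)

theorem chart_mem_chartTarget {x y : 𝒩.lim} (h : y ∈ 𝒩.chartSource x) :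
    𝒩.chart x y ∈ 𝒩.chartTarget x := fun i => by
  rw [chart_apply h]
  exact (extChartAt (𝒩.N i).I (x.1 i)).map_source (h i)

theorem isOpen_chartTarget (x : 𝒩.lim) : IsOpen (𝒩.chartTarget x) := by
  have h : 𝒩.chartTarget x =
      (fun e : 𝒩.model => e.1 0) ⁻¹' (extChartAt (𝒩.N 0).I (x.1 0)).target :=
    Set.ext fun e => mem_chartTarget_iff x e
  rw [h]
  exact (isOpen_extChartAt_target _).preimage ((continuous_apply 0).comp continuous_subtype_val)

theorem p_chartSymm (i : ℕ) (x : 𝒩.N (i + 1)) {e : (𝒩.N (i + 1)).E}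
    (he : e ∈ (extChartAt (𝒩.N (i + 1)).I x).target) :
    𝒩.p i ((extChartAt (𝒩.N (i + 1)).I x).symm e) =
      (extChartAt (𝒩.N i).I (𝒩.p i x)).symm (𝒩.ρ i e) := by
  have hs := (extChartAt (𝒩.N (i + 1)).I x).map_target he
  have h1 := 𝒩.chart_comm i x _ hs
  rw [(extChartAt (𝒩.N (i + 1)).I x).right_inv he] at h1
  rw [h1, (extChartAt (𝒩.N i).I (𝒩.p i x)).left_inv ((𝒩.source_iff i x _).1 hs)]

/-! ### Smoothness of limit maps -/

namespace Hom

variable (F : Hom 𝒩 𝒬)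

/-- The expression of `F.f i` in the charts around `x` and `F.f i x`. -/
def localRep (i : ℕ) (x : 𝒩.N i) (e : (𝒩.N i).E) : (𝒬.N i).E :=
  extChartAt (𝒬.N i).I (F.f i x) (F.f i ((extChartAt (𝒩.N i).I x).symm e))

/-- The domain of `F.localRep i x`. -/
def localDomain (i : ℕ) (x : 𝒩.N i) : Set (𝒩.N i).E :=
  (extChartAt (𝒩.N i).I x).target ∩
    (fun e => F.f i ((extChartAt (𝒩.N i).I x).symm e)) ⁻¹'
      (extChartAt (𝒬.N i).I (F.f i x)).source

theorem isOpen_localDomain (i : ℕ) (x : 𝒩.N i) : IsOpen (F.localDomain i x) :=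
  ContinuousOn.isOpen_inter_preimage
    ((F.smooth i).continuous.comp_continuousOn (continuousOn_extChartAt_symm x))
    (isOpen_extChartAt_target x) (isOpen_extChartAt_source _)

theorem contDiffOn_localRep (i : ℕ) (x : 𝒩.N i) :
    ContDiffOn ℝ ∞ (F.localRep i x) (F.localDomain i x) := by
  rw [← contMDiffOn_iff_contDiffOn]
  refine ContMDiffOn.comp (contMDiffOn_extChartAt (I := (𝒬.N i).I) (x := F.f i x))
    (ContMDiff.comp_contMDiffOn (F.smooth i)
      ((contMDiffOn_extChartAt_symm x).mono inter_subset_left)) fun e he => ?_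
  rw [← extChartAt_source (𝒬.N i).I]
  exact he.2

theorem limMap_apply (x : 𝒩.lim) (i : ℕ) : (F.limMap x).1 i = F.f i (x.1 i) := rfl

theorem p_f (i : ℕ) (x : 𝒩.N (i + 1)) : 𝒬.p i (F.f (i + 1) x) = F.f i (𝒩.p i x) :=
  congrFun (F.comm i) x

theorem mem_localDomain_succ (i : ℕ) (x : 𝒩.N (i + 1)) (e : (𝒩.N (i + 1)).E) :
    e ∈ F.localDomain (i + 1) x ↔ 𝒩.ρ i e ∈ F.localDomain i (𝒩.p i x) := by
  -- The source condition descends only for `e` in the chart target, where `p_chartSymm` applies;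
  -- hence the dependence on `h`.
  have key : ∀ h : e ∈ (extChartAt (𝒩.N (i + 1)).I x).target, _ := fun h => by
    have := 𝒬.source_iff i (F.f (i + 1) x) (F.f (i + 1) ((extChartAt (𝒩.N (i + 1)).I x).symm e))
    rwa [p_f, p_f, p_chartSymm i x h] at this
  exact ⟨fun h => ⟨(𝒩.target_iff i x e).1 h.1, (key h.1).1 h.2⟩, fun h =>
    have h1 := (𝒩.target_iff i x e).2 h.1
    ⟨h1, (key h1).2 h.2⟩⟩

theorem ρ_localRep (i : ℕ) (x : 𝒩.N (i + 1)) {e : (𝒩.N (i + 1)).E}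
    (he : e ∈ F.localDomain (i + 1) x) :
    𝒬.ρ i (F.localRep (i + 1) x e) = F.localRep i (𝒩.p i x) (𝒩.ρ i e) := by
  rw [localRep, localRep, 𝒬.chart_comm i _ _ he.2, p_f, p_f, p_chartSymm i x he.1]

theorem ρ_iteratedFDeriv_localRep (n i : ℕ) (x : 𝒩.N (i + 1)) {e : (𝒩.N (i + 1)).E}
    (he : e ∈ F.localDomain (i + 1) x) (w : Fin n → (𝒩.N (i + 1)).E) :
    𝒬.ρ i (iteratedFDeriv ℝ n (F.localRep (i + 1) x) e w) =
      iteratedFDeriv ℝ n (F.localRep i (𝒩.p i x)) (𝒩.ρ i e) fun k => 𝒩.ρ i (w k) :=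
  iteratedFDeriv_intertwine (F.isOpen_localDomain (i + 1) x) (F.isOpen_localDomain i (𝒩.p i x))
    (fun e he => (F.mem_localDomain_succ i x e).1 he) (F.contDiffOn_localRep _ _)
    (F.contDiffOn_localRep _ _) (fun _ he => F.ρ_localRep i x he) n he w

/-- The domain of the expression of `F.limMap` in the limit charts around `x` and
`F.limMap x`. -/
def limDomain (x : 𝒩.lim) : Set 𝒩.model :=
  {e | e ∈ 𝒩.chartTarget x ∧ F.limMap (𝒩.chartSymm x e) ∈ 𝒬.chartSource (F.limMap x)}

theorem mem_localDomain_of_mem_limDomain {x : 𝒩.lim} {e : 𝒩.model} (he : e ∈ F.limDomain x)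
    (i : ℕ) : e.1 i ∈ F.localDomain i (x.1 i) := by
  refine ⟨he.1 i, ?_⟩
  have := he.2 i
  rwa [limMap_apply, limMap_apply, chartSymm_apply he.1] at this

theorem isOpen_limDomain (x : 𝒩.lim) : IsOpen (F.limDomain x) := by
  have h : F.limDomain x = (fun e : 𝒩.model => e.1 0) ⁻¹' F.localDomain 0 (x.1 0) := by
    ext e
    refine ⟨fun he => F.mem_localDomain_of_mem_limDomain he 0, fun he => ?_⟩
    have ht := (mem_chartTarget_iff x e).2 he.1
    refine ⟨ht, (mem_chartSource_iff _ _).2 ?_⟩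
    rw [limMap_apply, limMap_apply, chartSymm_apply ht]
    exact he.2
  rw [h]
  exact (F.isOpen_localDomain 0 _).preimage ((continuous_apply 0).comp continuous_subtype_val)

open Classical in
/-- The iterated directional derivatives of `F.limMap` in the limit charts. -/
def limDeriv (x : 𝒩.lim) (n : ℕ) (e : 𝒩.model) (w : Fin n → 𝒩.model) : 𝒬.model :=
  if he : e ∈ F.limDomain x then
    ⟨fun i => iteratedFDeriv ℝ n (F.localRep i (x.1 i)) (e.1 i) fun k => (w k).1 i, fun i => by
      have := F.ρ_iteratedFDeriv_localRep n i (x.1 (i + 1))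
        (F.mem_localDomain_of_mem_limDomain he (i + 1)) fun k => (w k).1 (i + 1)
      rw [this, x.2 i, e.2 i]
      exact congrArg _ (funext fun k => (w k).2 i)⟩
  else 0

theorem limDeriv_apply {x : 𝒩.lim} {n : ℕ} {e : 𝒩.model} (he : e ∈ F.limDomain x)
    (w : Fin n → 𝒩.model) (i : ℕ) :
    (F.limDeriv x n e w).1 i =
      iteratedFDeriv ℝ n (F.localRep i (x.1 i)) (e.1 i) fun k => (w k).1 i := by
  rw [limDeriv, dif_pos he]

theorem contDiffAt_localRep {x : 𝒩.lim} {e : 𝒩.model} (he : e ∈ F.limDomain x) (i : ℕ) :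
    ContDiffAt ℝ ∞ (F.localRep i (x.1 i)) (e.1 i) :=
  (F.contDiffOn_localRep i _).contDiffAt
    ((F.isOpen_localDomain i _).mem_nhds (F.mem_localDomain_of_mem_limDomain he i))

/-- The model carries the topology induced from the product, so continuity and convergence are
tested on each Banach coordinate, where the derivatives are Fréchet derivatives of `localRep`. -/
theorem bastianiSmoothOn_limMap (x : 𝒩.lim) :
    BastianiSmoothOn (fun e => 𝒬.chart (F.limMap x) (F.limMap (𝒩.chartSymm x e)))
      (F.limDomain x) := by
  refine ⟨F.limDeriv x, fun e he w => ?_, fun n => ?_, fun n e he v w => ?_⟩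
  · refine Subtype.ext (funext fun i => ?_)
    rw [F.limDeriv_apply he, chart_apply he.2, iteratedFDeriv_zero_apply, localRep, limMap_apply,
      limMap_apply, chartSymm_apply he.1]
  · rw [Topology.IsInducing.subtypeVal.continuousOn_iff, continuousOn_pi]
    intro i
    have hcoord : Continuous fun e : 𝒩.model => e.1 i :=
      (continuous_apply i).comp continuous_subtype_val
    have h1 : ContinuousOn (fun q : 𝒩.model × (Fin n → 𝒩.model) =>
        iteratedFDeriv ℝ n (F.localRep i (x.1 i)) (q.1.1 i)) (F.limDomain x ×ˢ univ) := by
      intro q hq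
      exact (ContinuousAt.comp (g := iteratedFDeriv ℝ n (F.localRep i (x.1 i)))
        ((F.contDiffAt_localRep hq.1 i).differentiableAt_iteratedFDeriv
          (by exact_mod_cast WithTop.coe_lt_top _)).continuousAt
        (hcoord.comp continuous_fst).continuousAt).continuousWithinAt
    have h2 : Continuous fun q : 𝒩.model × (Fin n → 𝒩.model) => fun k => (q.2 k).1 i :=
      continuous_pi fun k => hcoord.comp ((continuous_apply k).comp continuous_snd)
    -- Norm continuity of the multilinear derivative, with jointly continuous evaluation, gives
    -- continuity in point and directions together.
    exact (h1.eval h2.continuousOn).congr fun q hq => F.limDeriv_apply hq.1 q.2 i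
  · rw [tendsto_subtype_rng, tendsto_pi_nhds]
    intro i
    -- Keeps `e + t • v` in the open domain for small `t`, away from the default value `0` of
    -- `limDeriv`.
    have hline : Tendsto (fun t : ℝ => e + t • v) (𝓝[≠] 0) (𝓝 e) := by
      have : Continuous fun t : ℝ => e + t • v := by fun_prop
      simpa using (this.tendsto 0).mono_left nhdsWithin_le_nhds
    have h := tendsto_iteratedFDeriv_cons (F.contDiffAt_localRep he i) n (v.1 i)
      fun k => (w k).1 i
    have hcons : (fun k => (Fin.cons v w : Fin (n + 1) → 𝒩.model) k |>.1 i) =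
        Fin.cons (v.1 i) fun k => (w k).1 i := by
      funext k
      refine Fin.cases rfl (fun _ => rfl) k
    rw [F.limDeriv_apply he, hcons]
    refine h.congr' ?_
    filter_upwards [hline.eventually_mem ((F.isOpen_limDomain x).mem_nhds he)] with t ht
    simp only [SetLike.val_smul, Submodule.coe_sub, Pi.smul_apply, Pi.sub_apply]
    rw [F.limDeriv_apply ht, F.limDeriv_apply he]
    rfl

theorem continuous_limMap : Continuous F.limMap :=
  Continuous.subtype_mk (continuous_pi fun i =>
    (F.smooth i).continuous.comp ((continuous_apply i).comp continuous_subtype_val)) _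

theorem limSmooth_limMap : LimSmooth F.limMap :=
  ⟨F.continuous_limMap, F.bastianiSmoothOn_limMap⟩

end Hom

/-! ### The tangent map of the projection -/

/-- The fibre coordinate of a tangent vector in the chart at its own base point. -/
theorem fiberCoord_apply (ξ : 𝒩.tangent.lim) (i : ℕ) :
    (𝒩.fiberCoord ξ).1 i = (show (𝒩.N i).E × (𝒩.N i).E from
      extChartAt (𝒩.tangent.N i).I (ξ.1 i) (ξ.1 i)).2 :=
  congrArg Prod.snd (chart_apply (𝒩 := 𝒩.tangent) (mem_chartSource_self ξ) i)

/-- In charts `Dπ` sends `(x, y, X, Y)` to `(x, X)`, so the new fibre coordinate is the first half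
of `(X, Y)`. -/
theorem fiberCoord_limDProj_tower (M : BanachManifold.{u})
    (ξ : (tower M).tangent.tangent.lim) (i : ℕ) :
    ((tower M).fiberCoord ((tower M).limDProj ξ)).1 i =
      (((tower M).tangent.fiberCoord ξ).1 i).1 := by
  rw [fiberCoord_apply, fiberCoord_apply]
  exact congrArg Prod.snd
    (extChartAt_D_proj (M.iterTangent i) (ξ.1 i) (ξ.1 i) (mem_extChartAt_source _))

/-- In the limit charts, `limProj` is the projection to the first coordinate. -/
theorem chart_limProj_chartSymm (x : 𝒩.tangent.lim) {e : 𝒩.tangent.model}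
    (he : e ∈ 𝒩.tangent.chartTarget x) (i : ℕ) :
    (𝒩.chart (𝒩.limProj x) (𝒩.limProj (𝒩.tangent.chartSymm x e))).1 i = (e.1 i).1 := by
  have hm : ∀ i, (𝒩.tangent.chartSymm x e).1 i ∈
      (extChartAt (𝒩.tangent.N i).I (x.1 i)).source := fun i => by
    rw [chartSymm_apply he]
    exact (extChartAt (𝒩.tangent.N i).I (x.1 i)).map_target (he i)
  have hs : 𝒩.limProj (𝒩.tangent.chartSymm x e) ∈ 𝒩.chartSource (𝒩.limProj x) := fun i =>
    (mem_extChartAt_tangent_source (𝒩.N i) _ _).1 (hm i)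
  rw [chart_apply hs]
  have h := (extChartAt (𝒩.tangent.N i).I (x.1 i)).right_inv (he i)
  refine (extChartAt_tangent_fst (𝒩.N i) (x.1 i) ((𝒩.tangent.chartSymm x e).1 i)).symm.trans ?_
  rw [chartSymm_apply he]
  exact congrArg Prod.fst h

theorem chart_limProj_self (x : 𝒩.tangent.lim) (i : ℕ) :
    (𝒩.chart (𝒩.limProj x) (𝒩.limProj x)).1 i = ((𝒩.tangent.chart x x).1 i).1 := by
  rw [chart_apply (mem_chartSource_self _), chart_apply (mem_chartSource_self _)]
  rfl

/-- The tangent map of the projection `TT^∞M → T^∞M` is `limDProj`. -/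
theorem hasTangentMap_limProj_tower (M : BanachManifold.{u}) :
    HasTangentMap (tower M).limProj (tower M).limDProj := by
  rintro ξ x rfl
  refine ⟨rfl, ?_⟩
  set y := (tower M).tangent.limProj ξ
  set c := (tower M).tangent.chart y y
  set v := (tower M).tangent.fiberCoord ξ
  have hline : Tendsto (fun t : ℝ => c + t • v) (𝓝[≠] 0) (𝓝 c) := by
    have : Continuous fun t : ℝ => c + t • v := by fun_prop
    simpa using (this.tendsto 0).mono_left nhdsWithin_le_nhds
  have hc : c ∈ (tower M).tangent.chartTarget y := chart_mem_chartTarget (mem_chartSource_self y)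
  -- By linearity of `π_∞` in charts the difference quotient is constant for small nonzero `t`;
  -- smallness keeps `chartSymm` off its default value.
  refine tendsto_const_nhds.congr' ?_
  filter_upwards [hline.eventually_mem ((isOpen_chartTarget y).mem_nhds hc),
    self_mem_nhdsWithin] with t ht ht0
  refine Subtype.ext (funext fun i => ?_)
  rw [fiberCoord_limDProj_tower]
  simp only [SetLike.val_smul, Submodule.coe_sub, Pi.smul_apply, Pi.sub_apply]
  rw [chart_limProj_chartSymm y ht, chart_limProj_self y]
  change (v.1 i).1 = t⁻¹ • ((c.1 i).1 + t • (v.1 i).1 - (c.1 i).1)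
  rw [add_sub_cancel_left, inv_smul_smul₀ ht0]

/-! ### The limit semispray -/

/-- A morphism from `(TNᵢ)` to `(T²Nᵢ)` of semisprays has a semispray as its limit. -/
theorem isSemispray_limMap (F : Hom 𝒩.tangent 𝒩.tangent.tangent)
    (hF : ∀ i, (𝒩.N i).IsSemispray (F.f i)) : 𝒩.IsSemispray F.limMap where
  isVectorField :=
    { smooth := F.limSmooth_limMap
      proj_comp := funext fun x => Subtype.ext <| funext fun i =>
        congrFun (hF i).isVectorField.proj_comp (x.1 i) }
  D_proj_comp := funext fun x => Subtype.ext <| funext fun i =>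
    congrFun (hF i).D_proj_comp (x.1 i)

/-- The morphism formed by the iterated complete lifts of a semispray. -/
def iterCompleteLiftHom (M : BanachManifold.{u}) (S : M.tangent → M.tangent.tangent)
    (hS : M.IsSemispray S) : Hom (tower M).tangent (tower M).tangent.tangent where
  f := M.iterCompleteLift S
  smooth i := (hS.iterCompleteLift i).isVectorField.smooth
  comm i := D_D_proj_comp_completeLift (M.iterCompleteLift S i)

end ProjSystem

end

/-- Smoothness of each `S^{c_i}` and the relation `D²π_i ∘ S^{c_{i+1}} = S^{c_i} ∘ Dπ_i` are the
fields `smooth` and `comm` of the morphism `F`. -/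
theorem mainTheorem6 (M : BanachManifold.{u}) (S : M.tangent → M.tangent.tangent)
    (hS : M.IsSemispray S) :
    ∃ F : ProjSystem.Hom (ProjSystem.tower M).tangent (ProjSystem.tower M).tangent.tangent,
      (∀ i, F.f i = M.iterCompleteLift S i) ∧
      ProjSystem.HasTangentMap (ProjSystem.tower M).limProj (ProjSystem.tower M).limDProj ∧
      (ProjSystem.tower M).IsSemispray F.limMap :=
  ⟨ProjSystem.iterCompleteLiftHom M S hS, fun _ => rfl, ProjSystem.hasTangentMap_limProj_tower M,
    ProjSystem.isSemispray_limMap _ hS.iterCompleteLift⟩
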